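/- Let $a,b$ be coprime integers with $0<b<a$, and let $\mathcal D(a,b)$ be the set of lattice paths from $(0,0)$ to $(a,b)$ with unit East and North steps that never go above the diagonal from $(0,0)$ to $(a,b)$. There is a unique path $\omega_0\in\mathcal D(a,b)$ closest to the diagonal, the Christoffel path: for every $\omega\in\mathcal D(a,b)$ and every $k$, the point of $\omega_0$ after $k$ steps is at most as far from the diagonal as the point of $\omega$ after $k$ steps. For $\omega\in\mathcal D(a,b)$, place square tiles of side length $1/2$ along the north-west side of $\omega$: the tiles are the squares whose south-east corners are the $2(a+b)-1$ points at distance $\tfrac12,1,\tfrac32,\dots,a+b-\tfrac12$ from $(0,0)$ along $\omega$. Remove the first and the last tile. The snake graph $\mathcal G(\omega)$ is the planar graph whose vertices and edges are the corners and the sides of the remaining tiles. Let $M(\omega)$ be the number of perfect matchings of $\mathcal G(\omega)$, and write $\omega<_M\omega'$ if $M(\omega)<M(\omega')$. For a rational number $0<q<1$, the Markov number $m_q$ is defined by matching two infinite binary trees. The Farey tree has root $(\tfrac01,\tfrac12,\tfrac11)$, and a node $(l,c,r)$ has left child $(l,l\oplus c,c)$ and right child $(c,c\oplus r,r)$, where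 $\frac{p}{s}\oplus\frac{p'}{s'}=\frac{p+p'}{s+s'}$. The Markov tree has root $(1,5,2)$, and a node $(x,y,z)$ has left child $(x,3xy-z,y)$ and right child $(y,3yz-x,z)$; its nodes are solutions of $x^2+y^2+z^2=3xyz$. Every rational $q\in(0,1)$ is the middle entry of exactly one node of the Farey tree, and $m_q$ is the middle (largest) entry of the node of the Markov tree at the same position; thus $m_{1/2}=5$, $m_{1/3}=13$, $m_{2/3}=29$. Then $$M(\omega_0)=m_{b/a},$$ and $\omega_0$ is the unique minimal element of $\mathcal D(a,b)$ with respect to $<_M$; that is, a path $\omega\in\mathcal D(a,b)$ satisfies $M(\omega')\ge M(\omega)$ for all $\omega'\in\mathcal D(a,b)$ if and only if $\omega=\omega_0$. -/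

import Mathlib

/-! ### Lattice paths -/

/-- The two kinds of steps of a lattice path: East (`R`, right) and North (`U`, up). -/
inductive Step
  | R
  | U
  deriving DecidableEq

/-- The lattice point reached from `(0,0)` after the first `k` steps of the path `w`. -/
def pointAt (w : List Step) (k : ℕ) : ℤ × ℤ :=
  (((w.take k).count Step.R : ℤ), ((w.take k).count Step.U : ℤ))

/-- For the diagonal from `(0,0)` to `(a,b)`: the quantity `b x - a y`. It is `√(a² + b²)` times the
signed distance of the point `(x,y)` from the diagonal, nonnegative exactly when the point is not
above the diagonal. -/
def diagGap (a b : ℕ) (p : ℤ × ℤ) : ℤ := (b : ℤ) * p.1 - (a : ℤ) * p.2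

/-- `𝓓(a,b)`: the lattice paths from `(0,0)` to `(a,b)` with East and North steps that never go
above the diagonal. -/
def latticePaths (a b : ℕ) : Set (List Step) :=
  {w | w.count Step.R = a ∧ w.count Step.U = b ∧ ∀ k, 0 ≤ diagGap a b (pointAt w k)}

/-- `w` is the path in `𝓓(a,b)` closest to the diagonal: after every number `k` of steps it is at
most as far from the diagonal as any other path of `𝓓(a,b)`. -/
def IsChristoffelPath (a b : ℕ) (w : List Step) : Prop :=
  w ∈ latticePaths a b ∧
    ∀ w' ∈ latticePaths a b, ∀ k, diagGap a b (pointAt w k) ≤ diagGap a b (pointAt w' k)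

/-! ### Snake graphs

Tiles are unit squares with corners in `ℤ × ℤ`; a tile is given by its south-west corner. -/

/-- The four corners of a tile. -/
def tileCorners (t : ℤ × ℤ) : Finset (ℤ × ℤ) :=
  {(t.1, t.2), (t.1 + 1, t.2), (t.1, t.2 + 1), (t.1 + 1, t.2 + 1)}

/-- The four sides (south, north, west, east) of a tile. -/
def tileSides (t : ℤ × ℤ) : Finset (Sym2 (ℤ × ℤ)) :=
  {s((t.1, t.2), (t.1 + 1, t.2)), s((t.1, t.2 + 1), (t.1 + 1, t.2 + 1)),
   s((t.1, t.2), (t.1, t.2 + 1)), s((t.1 + 1, t.2), (t.1 + 1, t.2 + 1))}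

/-- The vertices of the planar graph formed by a sequence of tiles. -/
abbrev TileVertex (T : List (ℤ × ℤ)) : Type :=
  {v : ℤ × ℤ // ∃ t ∈ T, v ∈ tileCorners t}

/-- The planar graph formed by a sequence of tiles: its vertices are the corners of the tiles and
its edges are the sides of the tiles. -/
def tileGraph (T : List (ℤ × ℤ)) : SimpleGraph (TileVertex T) where
  Adj u v := ∃ t ∈ T, s(u.1, v.1) ∈ tileSides t
  symm := ⟨fun u v ⟨t, ht, h⟩ => ⟨t, ht, by rwa [Sym2.eq_swap]⟩⟩
  loopless := ⟨fun u ⟨t, _, h⟩ => by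
    simp only [tileSides, Finset.mem_insert, Finset.mem_singleton, Sym2.eq_iff] at h
    rcases h with h | h | h | h <;> rcases h with ⟨h1, h2⟩ | ⟨h1, h2⟩ <;>
      · have h3 := h1.symm.trans h2
        simp [Prod.ext_iff] at h3⟩

/-- The tiles of side length `1/2` placed along the path `w`, in order, scaled by a factor `2` to
unit squares. The path scaled by `2` is the one in which every step is doubled, of length
`2 * w.length`; the tiles lie on its north-west side, and each of its intermediate points (all points
but the two endpoints) is the south-east corner of one tile. -/
def tilesAlong (w : List Step) : List (ℤ × ℤ) :=
  (List.range' 1 (2 * w.length - 1)).map fun k =>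
    pointAt (w.flatMap fun s => [s, s]) k - (1, 0)

/-- The tiles of the snake graph `𝓖(w)`: remove the first and the last tile along `w`. -/
def snakeTiles (w : List Step) : List (ℤ × ℤ) := (tilesAlong w).tail.dropLast

/-- The snake graph `𝓖(w)` of the lattice path `w`. -/
def snakeGraph (w : List Step) : SimpleGraph (TileVertex (snakeTiles w)) :=
  tileGraph (snakeTiles w)

/-- `M(w)`: the number of perfect matchings of the snake graph `𝓖(w)`. -/
noncomputable def matchNumber (w : List Step) : ℕ :=
  Nat.card {P : (snakeGraph w).Subgraph // P.IsPerfectMatching}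

/-- The matching order `w <_M w'`. -/
def MatchingLT (w w' : List Step) : Prop := matchNumber w < matchNumber w'

/-- `w` is a minimal element of `(𝓓(a,b), <_M)`. -/
def IsMatchingMinimal (a b : ℕ) (w : List Step) : Prop :=
  w ∈ latticePaths a b ∧ ∀ w' ∈ latticePaths a b, ¬ MatchingLT w' w

/-! ### Markov numbers

The Farey tree and the Markov tree are binary trees; a position in them is the sequence of
branches taken from the root. -/

/-- The two branches at a node of a binary tree. -/
inductive Branch
  | left
  | right

/-- The fraction at a position of the Farey tree below the interval with endpoints `l.1 / l.2` and
`r.1 / r.2`. The root carries the mediant; the left and right subtrees belong to the subintervals to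
the left and to the right of the mediant. -/
def fareyNode (l r : ℕ × ℕ) : List Branch → ℕ × ℕ
  | [] => l + r
  | Branch.left :: p => fareyNode l (l + r) p
  | Branch.right :: p => fareyNode (l + r) r p

/-- The rational number at a position of the Farey tree of `(0,1)`, with root `1/2`. -/
def fareyLabel (p : List Branch) : ℚ :=
  ((fareyNode (0, 1) (1, 1) p).1 : ℚ) / ((fareyNode (0, 1) (1, 1) p).2 : ℚ)

/-- The triple at a position of the tree of Markov triples below `(x, y, z)`, where `y` is the
largest entry: the left child replaces `z` and the right child replaces `x` by the other root of the
Markov equation, and the new largest entry is put into the middle. -/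
def markovNode : ℤ × ℤ × ℤ → List Branch → ℤ × ℤ × ℤ
  | t, [] => t
  | (x, y, z), Branch.left :: p => markovNode (x, 3 * x * y - z, y) p
  | (x, y, z), Branch.right :: p => markovNode (y, 3 * y * z - x, z) p

/-- The Markov number at a position of the Markov tree: the largest entry of the triple there. The
root triple `(1, 5, 2)` is at the position of the Farey triple `(0/1, 1/2, 1/1)`. -/
def markovLabel (p : List Branch) : ℤ := (markovNode (1, 5, 2) p).2.1

/-- Every node of the Markov tree is a Markov triple of positive integers with the largest entry in
the middle. -/
theorem markovNode_spec (p : List Branch) (x y z : ℤ) (hx : 0 < x) (hz : 0 < z) (hxy : x < y)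
    (hzy : z < y) (h : x ^ 2 + y ^ 2 + z ^ 2 = 3 * x * y * z) :
    0 < (markovNode (x, y, z) p).1 ∧ 0 < (markovNode (x, y, z) p).2.2 ∧
      (markovNode (x, y, z) p).1 < (markovNode (x, y, z) p).2.1 ∧
      (markovNode (x, y, z) p).2.2 < (markovNode (x, y, z) p).2.1 ∧
      (markovNode (x, y, z) p).1 ^ 2 + (markovNode (x, y, z) p).2.1 ^ 2 +
          (markovNode (x, y, z) p).2.2 ^ 2 =
        3 * (markovNode (x, y, z) p).1 * (markovNode (x, y, z) p).2.1 *
          (markovNode (x, y, z) p).2.2 := by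
  induction p generalizing x y z with
  | nil => exact ⟨hx, hz, hxy, hzy, h⟩
  | cons s p ih =>
    cases s
    · exact ih x _ y hx (by linarith) (by nlinarith) (by nlinarith) (by linear_combination h)
    · exact ih y _ z (by linarith) hz (by nlinarith) (by nlinarith) (by linear_combination h)

theorem fareyNode_between (p : List Branch) (l r : ℕ × ℕ) (hl : 0 < l.2) (hr : 0 < r.2)
    (h : l.1 * r.2 < r.1 * l.2) :
    0 < (fareyNode l r p).2 ∧ l.1 * (fareyNode l r p).2 < (fareyNode l r p).1 * l.2 ∧
      (fareyNode l r p).1 * r.2 < r.1 * (fareyNode l r p).2 := by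
  induction p generalizing l r with
  | nil => simp only [fareyNode, Prod.fst_add, Prod.snd_add]; refine ⟨?_, ?_, ?_⟩ <;> nlinarith
  | cons s p ih =>
    cases s
    · obtain ⟨h1, h2, h3⟩ := ih l (l + r) hl (by simp; omega) (by simp; nlinarith)
      refine ⟨h1, h2, ?_⟩
      simp only [fareyNode, Prod.fst_add, Prod.snd_add] at h1 h2 h3 ⊢
      set n := fareyNode l (l + r) p
      by_contra hc
      nlinarith
    · obtain ⟨h1, h2, h3⟩ := ih (l + r) r (by simp; omega) hr (by simp; nlinarith)
      refine ⟨h1, ?_, h3⟩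
      simp only [fareyNode, Prod.fst_add, Prod.snd_add] at h1 h2 h3 ⊢
      set n := fareyNode (l + r) r p
      by_contra hc
      nlinarith

theorem fareyNode_injective (p q : List Branch) (l r : ℕ × ℕ) (hl : 0 < l.2) (hr : 0 < r.2)
    (h : l.1 * r.2 < r.1 * l.2)
    (e : (fareyNode l r p).1 * (fareyNode l r q).2 = (fareyNode l r q).1 * (fareyNode l r p).2) :
    p = q := by
  induction p generalizing q l r with
  | nil =>
    have hm : 0 < (l + r).2 := Nat.add_pos_left hl _
    have h1 : l.1 * (l + r).2 < (l + r).1 * l.2 := by simp only [Prod.fst_add, Prod.snd_add]; linarith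
    have h2 : (l + r).1 * r.2 < r.1 * (l + r).2 := by simp only [Prod.fst_add, Prod.snd_add]; linarith
    rcases q with _ | ⟨_ | _, q⟩
    · rfl
    · exact absurd e (fareyNode_between q l (l + r) hl hm h1).2.2.ne'
    · exact absurd e (fareyNode_between q (l + r) r hm hr h2).2.1.ne
  | cons s p ih =>
    have hm : 0 < (l + r).2 := Nat.add_pos_left hl _
    have h1 : l.1 * (l + r).2 < (l + r).1 * l.2 := by simp only [Prod.fst_add, Prod.snd_add]; linarith
    have h2 : (l + r).1 * r.2 < r.1 * (l + r).2 := by simp only [Prod.fst_add, Prod.snd_add]; linarith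
    have key : ∀ p q, ¬ (fareyNode l (l + r) p).1 * (fareyNode (l + r) r q).2 =
        (fareyNode (l + r) r q).1 * (fareyNode l (l + r) p).2 := by
      intro p q e
      obtain ⟨a1, -, a3⟩ := fareyNode_between p l (l + r) hl hm h1
      obtain ⟨b1, b2, -⟩ := fareyNode_between q (l + r) r hm hr h2
      have c1 := Nat.mul_lt_mul_of_pos_right a3 b1
      have c2 := Nat.mul_lt_mul_of_pos_right b2 a1
      have c3 := congrArg (· * (l + r).2) e
      linarith
    rcases s with _ | _ <;> rcases q with _ | ⟨_ | _, q⟩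
    · exact absurd e (fareyNode_between p l (l + r) hl hm h1).2.2.ne
    · rw [ih q l (l + r) hl hm h1 e]
    · exact (key _ _ e).elim
    · exact absurd e (fareyNode_between p (l + r) r hm hr h2).2.1.ne'
    · exact (key _ _ e.symm).elim
    · rw [ih q (l + r) r hm hr h2 e]

theorem exists_fareyNode (n x y : ℕ) (hn : x + y ≤ n) (hx : 0 < x) (hy : 0 < y)
    (h : Nat.Coprime x y) (l r : ℕ × ℕ) : ∃ p, fareyNode l r p = x • l + y • r := by
  induction n generalizing x y l r with
  | zero => omega
  | succ n ih =>
    rcases lt_trichotomy x y with hlt | rfl | hlt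
    · obtain ⟨k, rfl⟩ := Nat.exists_eq_add_of_lt hlt
      obtain ⟨p, hp⟩ := ih x (k + 1) (by omega) hx (by omega)
        (by rwa [add_assoc, Nat.coprime_self_add_right] at h) (l + r) r
      refine ⟨Branch.right :: p, ?_⟩
      rw [fareyNode, hp]
      module
    · have : x = 1 := by simpa using h
      subst this
      exact ⟨[], by simp [fareyNode]⟩
    · obtain ⟨k, rfl⟩ := Nat.exists_eq_add_of_lt hlt
      obtain ⟨p, hp⟩ := ih (k + 1) y (by omega) (by omega) hy
        (by rwa [add_assoc, Nat.coprime_self_add_left] at h) l (l + r)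
      refine ⟨Branch.left :: p, ?_⟩
      rw [fareyNode, hp]
      module

/-- Every fraction `b/a` with coprime `0 < b < a` occurs at exactly one position of the Farey tree. -/
theorem existsUnique_fareyLabel (a b : ℕ) (hb : 0 < b) (hba : b < a) (h : Nat.Coprime a b) :
    ∃! p : List Branch, fareyLabel p = (b : ℚ) / (a : ℚ) := by
  have pos := fun p => (fareyNode_between p (0, 1) (1, 1) one_pos one_pos (by simp)).1
  obtain ⟨p, hp⟩ := exists_fareyNode a (a - b) b (by omega) (by omega) hb
    ((Nat.coprime_sub_self_left hba.le).2 h) (0, 1) (1, 1)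
  have hp1 : fareyLabel p = (b : ℚ) / (a : ℚ) := by
    rw [fareyLabel, hp]
    simp [Nat.cast_sub hba.le]
  refine ⟨p, hp1, fun q hq => ?_⟩
  have e := hq.trans hp1.symm
  have pq := pos q
  have pp := pos p
  rw [fareyLabel, fareyLabel, div_eq_div_iff (by positivity) (by positivity)] at e
  exact fareyNode_injective q p (0, 1) (1, 1) one_pos one_pos (by simp) (by exact_mod_cast e)

open Classical in
/-- The Markov number `m_q` of a rational number `0 < q < 1`: the number in the Markov tree at the
position that `q` has in the Farey tree (which exists and is unique). -/
noncomputable def markovNumber (q : ℚ) : ℤ :=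
  if h : ∃ p : List Branch, fareyLabel p = q then markovLabel h.choose else 0

/-!
A path of `𝓓(a,b)` has the form `R v U`, and its snake graph is an induced subgraph of the square
grid, built from the word `v` with every step doubled. Expanding the number of perfect matchings at
the south-west corner of the first tile gives a linear recursion for the two counts in which a
south or west side of that tile has been deleted (`cutCount_doubled`). Hence the matching number of
`w = R v U` is the lower left entry of the product `pathMatrix w` of the matrices
`A = !![2, 1; 1, 1]` for `R` and `B = !![1, 1; 1, 2]` for `U` (`matchNumber_eq`).

*Markov numbers.* For Farey neighbours with words `u`, `v`, the word of the mediant is `u ++ v`. By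
Cayley–Hamilton `X(u u v) = tr X(u) • X(u v) - X(v)`, and symmetrically for `u v v`. The linear
relation `tr X = 3 X₁₀` holds at the root, so it propagates through the tree, and then the entries
`X₁₀` satisfy the recursion of the Markov tree (`pathMatrix_christoffelWord`). The words of the tree
stay in the strip `0 ≤ b x - a y < a + b` (`isBalanced_christoffelWord`). After `k` steps the values
`b x - a y` of all paths are congruent modulo `a + b`, so a word in the strip is the Christoffel path
(`IsBalanced.isChristoffelPath`).

*Minimality.* Since `A * B - B * A = !![0, 2; -2, 0]`, replacing a corner `R U` by `U R` changes the
matching number by a determinant, whose sign is a lexicographic comparison of the words that leave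
the corner backwards and forwards (`pathMatrix_flip_sub`, `wordCross_pos_or`). A path that leaves the
strip has a corner `R U` of maximal gap, at least `a + b`; flipping it stays below the diagonal, and
maximality together with coprimality makes the matching number drop
(`wordCross_pos_of_maximal_corner`). So a minimal path lies in the strip, and it is the Christoffel
path.
-/

/-! ### Perfect matchings as involutions -/

/-- The matchings of `G` that cover exactly the vertices in `S`, encoded as the involutions of `V`
that fix every vertex outside `S` and send every vertex of `S` to its partner. -/
def matchingPerms {V : Type*} (G : SimpleGraph V) (S : Set V) : Set (Equiv.Perm V) :=
  {σ | (∀ x, σ (σ x) = x) ∧ (∀ x ∈ S, G.Adj x (σ x)) ∧ ∀ x ∉ S, σ x = x}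

theorem apply_mem_of_mem_matchingPerms {V : Type*} {G : SimpleGraph V} {S : Set V}
    {σ : Equiv.Perm V} (hσ : σ ∈ matchingPerms G S) {x : V} (hx : x ∈ S) : σ x ∈ S := by
  by_contra h
  have h1 := hσ.2.2 _ h
  rw [hσ.1] at h1
  exact (hσ.2.1 x hx).ne h1

theorem finite_matchingPerms {V : Type*} (G : SimpleGraph V) {S : Set V} (hS : S.Finite) :
    (matchingPerms G S).Finite := by
  classical
  have := hS.to_subtype
  have h : Finite {f : Equiv.Perm V // ∀ a, ¬ a ∈ S → f a = a} :=
    Finite.of_equiv _ (Equiv.Perm.subtypeEquivSubtypePerm (· ∈ S))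
  exact Set.Finite.subset (s := {f : Equiv.Perm V | ∀ a, ¬ a ∈ S → f a = a}) h
    fun σ hσ => hσ.2.2

/-- Matchings in which `v` and `u` are partners correspond to matchings of what remains after
deleting `v` and `u`. -/
theorem ncard_matchingPerms_apply_eq {V : Type*} {G : SimpleGraph V} {S : Set V} {u v : V}
    (hv : v ∈ S) (hu : u ∈ S) (huv : G.Adj v u) :
    {σ ∈ matchingPerms G S | σ v = u}.ncard = (matchingPerms G (S \ {v, u})).ncard := by
  classical
  have hne : v ≠ u := huv.ne
  have key : (fun σ : Equiv.Perm V => σ * Equiv.swap v u) ''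
      {σ ∈ matchingPerms G S | σ v = u} = matchingPerms G (S \ {v, u}) := by
    ext τ
    constructor
    · rintro ⟨σ, ⟨⟨h1, h2, h3⟩, h4⟩, rfl⟩
      have h5 : σ u = v := by rw [← h4, h1]
      have hv' : ∀ x, x ≠ v → x ≠ u → σ x ≠ v ∧ σ x ≠ u := fun x a b =>
        ⟨fun h => b (by rw [← h1 x, h, h4]), fun h => a (by rw [← h1 x, h, h5])⟩
      have e : ∀ x, x ≠ v → x ≠ u → (σ * Equiv.swap v u) x = σ x := fun x a b => by
        simp [Equiv.swap_apply_of_ne_of_ne a b]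
      have ev : (σ * Equiv.swap v u) v = v := by simp [h5]
      have eu : (σ * Equiv.swap v u) u = u := by simp [h4]
      refine ⟨fun x => ?_, fun x hx => ?_, fun x hx => ?_⟩
      · rcases eq_or_ne x v with rfl | a
        · rw [ev, ev]
        rcases eq_or_ne x u with rfl | b
        · rw [eu, eu]
        · rw [e x a b, e _ (hv' x a b).1 (hv' x a b).2, h1]
      · simp only [Set.mem_sdiff, Set.mem_insert_iff, Set.mem_singleton_iff, not_or] at hx
        rw [e x hx.2.1 hx.2.2]
        exact h2 x hx.1
      · rcases eq_or_ne x v with rfl | a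
        · exact ev
        rcases eq_or_ne x u with rfl | b
        · exact eu
        · rw [e x a b]
          exact h3 x fun h => hx ⟨h, by simp [a, b]⟩
    · rintro ⟨h1, h2, h3⟩
      have hv0 : τ v = v := h3 v (by simp)
      have hu0 : τ u = u := h3 u (by simp)
      have hv' : ∀ x, x ≠ v → x ≠ u → τ x ≠ v ∧ τ x ≠ u := fun x a b =>
        ⟨fun h => a (by rw [← h1 x, h, hv0]), fun h => b (by rw [← h1 x, h, hu0])⟩
      have e : ∀ x, x ≠ v → x ≠ u → (τ * Equiv.swap v u) x = τ x := fun x a b => by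
        simp [Equiv.swap_apply_of_ne_of_ne a b]
      have ev : (τ * Equiv.swap v u) v = u := by simp [hu0]
      have eu : (τ * Equiv.swap v u) u = v := by simp [hv0]
      refine ⟨τ * Equiv.swap v u, ⟨⟨fun x => ?_, fun x hx => ?_, fun x hx => ?_⟩, ev⟩, ?_⟩
      · rcases eq_or_ne x v with rfl | a
        · rw [ev, eu]
        rcases eq_or_ne x u with rfl | b
        · rw [eu, ev]
        · rw [e x a b, e _ (hv' x a b).1 (hv' x a b).2, h1]
      · rcases eq_or_ne x v with rfl | a
        · rw [ev]; exact huv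
        rcases eq_or_ne x u with rfl | b
        · rw [eu]; exact huv.symm
        · rw [e x a b]
          exact h2 x ⟨hx, by simp [a, b]⟩
      · have a : x ≠ v := fun h => hx (h ▸ hv)
        have b : x ≠ u := fun h => hx (h ▸ hu)
        rw [e x a b]
        exact h3 x fun h => hx h.1
      · simp [mul_assoc]
  rw [← key, Set.ncard_image_of_injective _ (mul_left_injective _)]

/-- A vertex with a single available neighbour is matched to it. -/
theorem ncard_matchingPerms_of_unique {V : Type*} {G : SimpleGraph V} {S : Set V} {u v : V}
    (hv : v ∈ S) (hu : u ∈ S) (huv : G.Adj v u) (h : ∀ x ∈ S, G.Adj v x → x = u) :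
    (matchingPerms G S).ncard = (matchingPerms G (S \ {v, u})).ncard := by
  rw [← ncard_matchingPerms_apply_eq hv hu huv]
  congr 1
  ext σ
  exact ⟨fun hσ => ⟨hσ, h _ (apply_mem_of_mem_matchingPerms hσ hv) (hσ.2.1 v hv)⟩, fun hσ => hσ.1⟩

/-- Expansion of the number of matchings at a vertex with two available neighbours. -/
theorem ncard_matchingPerms_of_two {V : Type*} {G : SimpleGraph V} {S : Set V} (hS : S.Finite)
    {u u' v : V} (hv : v ∈ S) (hu : u ∈ S) (hu' : u' ∈ S) (huv : G.Adj v u) (huv' : G.Adj v u')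
    (hne : u ≠ u') (h : ∀ x ∈ S, G.Adj v x → x = u ∨ x = u') :
    (matchingPerms G S).ncard =
      (matchingPerms G (S \ {v, u})).ncard + (matchingPerms G (S \ {v, u'})).ncard := by
  have fin : ∀ y, {σ ∈ matchingPerms G S | σ v = y}.Finite := fun y =>
    (finite_matchingPerms G hS).subset fun _ h => h.1
  rw [← ncard_matchingPerms_apply_eq hv hu huv, ← ncard_matchingPerms_apply_eq hv hu' huv',
    ← Set.ncard_union_eq ?_ (fin u) (fin u')]
  · congr 1
    ext σ
    constructor
    · intro hσ
      rcases h _ (apply_mem_of_mem_matchingPerms hσ hv) (hσ.2.1 v hv) with e | e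
      · exact Or.inl ⟨hσ, e⟩
      · exact Or.inr ⟨hσ, e⟩
    · rintro (hσ | hσ) <;> exact hσ.1
  · exact Set.disjoint_left.2 fun σ h1 h2 => hne (h1.2.symm.trans h2.2)

/-- The perfect matchings of an induced subgraph of `G`, given on the subtype of its vertices, are
counted by the involutions of the ambient vertex type. -/
theorem card_perfectMatching_eq_ncard {V : Type*} (G : SimpleGraph V) (p : V → Prop)
    (H : SimpleGraph {v // p v}) (hH : ∀ x y, H.Adj x y ↔ G.Adj x.1 y.1) :
    Nat.card {P : H.Subgraph // P.IsPerfectMatching} = (matchingPerms G {v | p v}).ncard := by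
  classical
  rw [← Nat.card_coe_set_eq]
  symm
  let f : matchingPerms G {v | p v} → {P : H.Subgraph // P.IsPerfectMatching} := fun σ =>
    ⟨{ verts := Set.univ
       Adj := fun x y => σ.1 x.1 = y.1
       adj_sub := fun {x y} h => (hH x y).2 (h ▸ σ.2.2.1 x.1 x.2)
       edge_vert := fun _ => Set.mem_univ _
       symm := ⟨fun x y h => by rw [← h, σ.2.1]⟩ },
      ⟨fun x _ => ⟨⟨σ.1 x.1, apply_mem_of_mem_matchingPerms σ.2 x.2⟩, rfl,
        fun y hy => Subtype.ext (Eq.symm hy)⟩, fun x => Set.mem_univ _⟩⟩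
  refine Nat.card_eq_of_bijective f ⟨fun σ τ h => ?_, fun P => ?_⟩
  · apply Subtype.ext
    ext x
    by_cases hx : p x
    · have h1 : (f σ).1.Adj ⟨x, hx⟩ ⟨σ.1 x, apply_mem_of_mem_matchingPerms σ.2 hx⟩ := rfl
      rw [h] at h1
      exact Eq.symm h1
    · rw [σ.2.2.2 x hx, τ.2.2.2 x hx]
  · obtain ⟨P, hP, hs⟩ := P
    choose g hg hg' using fun x => hP (hs x)
    have hinv : Function.Involutive g := fun x => (hg' _ _ (hg x).symm).symm
    refine ⟨⟨Equiv.Perm.ofSubtype hinv.toPerm, fun x => ?_, fun x hx => ?_, fun x hx => ?_⟩, ?_⟩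
    · by_cases hx : p x
      · rw [Equiv.Perm.ofSubtype_apply_of_mem _ hx, Equiv.Perm.ofSubtype_apply_coe]
        simp [hinv _]
      · rw [Equiv.Perm.ofSubtype_apply_of_not_mem _ hx, Equiv.Perm.ofSubtype_apply_of_not_mem _ hx]
    · rw [Equiv.Perm.ofSubtype_apply_of_mem _ hx]
      exact (hH _ _).1 (hg ⟨x, hx⟩).adj_sub
    · exact Equiv.Perm.ofSubtype_apply_of_not_mem _ hx
    · apply Subtype.ext
      refine SimpleGraph.Subgraph.ext (Set.eq_univ_of_forall hs).symm ?_
      ext x y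
      change Equiv.Perm.ofSubtype hinv.toPerm x.1 = y.1 ↔ P.Adj x y
      rw [Equiv.Perm.ofSubtype_apply_coe]
      constructor
      · intro h
        have : g x = y := Subtype.ext h
        exact this ▸ hg x
      · intro h
        exact congrArg Subtype.val (hg' x y h).symm

/-! ### Snake graphs as induced subgraphs of the square grid -/

/-- The square grid on `ℤ × ℤ`: lattice points at distance `1` are adjacent. -/
def gridGraph : SimpleGraph (ℤ × ℤ) where
  Adj u v := (u.1 = v.1 ∧ (u.2 = v.2 + 1 ∨ v.2 = u.2 + 1)) ∨
    (u.2 = v.2 ∧ (u.1 = v.1 + 1 ∨ v.1 = u.1 + 1))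
  symm := ⟨fun u v h => by omega⟩
  loopless := ⟨fun u h => by omega⟩

theorem gridGraph_adj {u v : ℤ × ℤ} : gridGraph.Adj u v ↔
    (u.1 = v.1 ∧ (u.2 = v.2 + 1 ∨ v.2 = u.2 + 1)) ∨
      (u.2 = v.2 ∧ (u.1 = v.1 + 1 ∨ v.1 = u.1 + 1)) := Iff.rfl

/-- The lattice vector of a step. -/
def stepVec : Step → ℤ × ℤ
  | Step.R => (1, 0)
  | Step.U => (0, 1)

/-- The sequence of tiles that starts at the tile `t` and in which each tile lies to the right of or
above the preceding one, as prescribed by a word of steps. -/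
def snakeFrom (t : ℤ × ℤ) : List Step → List (ℤ × ℤ)
  | [] => [t]
  | s :: w => t :: snakeFrom (t + stepVec s) w

/-- The set of corners of a sequence of tiles. -/
def cornerSet (T : List (ℤ × ℤ)) : Set (ℤ × ℤ) := {v | ∃ t ∈ T, v ∈ tileCorners t}

theorem mem_tileCorners {t v : ℤ × ℤ} :
    v ∈ tileCorners t ↔ (v.1 = t.1 ∨ v.1 = t.1 + 1) ∧ (v.2 = t.2 ∨ v.2 = t.2 + 1) := by
  simp only [tileCorners, Finset.mem_insert, Finset.mem_singleton, Prod.ext_iff]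
  omega

theorem mem_tileSides {t u v : ℤ × ℤ} :
    s(u, v) ∈ tileSides t ↔ u ∈ tileCorners t ∧ v ∈ tileCorners t ∧ gridGraph.Adj u v := by
  simp only [tileSides, Finset.mem_insert, Finset.mem_singleton, Sym2.eq_iff, mem_tileCorners,
    gridGraph_adj, Prod.ext_iff]
  omega

theorem finite_cornerSet (T : List (ℤ × ℤ)) : (cornerSet T).Finite := by
  have : cornerSet T = ⋃ t ∈ {t | t ∈ T}, (tileCorners t : Set (ℤ × ℤ)) := by
    ext v; simp [cornerSet]
  rw [this]
  exact (List.finite_toSet T).biUnion fun t _ => Finset.finite_toSet _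

theorem mem_snakeFrom_self (t : ℤ × ℤ) (w : List Step) : t ∈ snakeFrom t w := by
  cases w <;> simp [snakeFrom]

theorem mem_cornerSet_snakeFrom_of_mem {t v : ℤ × ℤ} (w : List Step) (h : v ∈ tileCorners t) :
    v ∈ cornerSet (snakeFrom t w) := ⟨t, mem_snakeFrom_self t w, h⟩

theorem le_of_mem_cornerSet_snakeFrom {t v : ℤ × ℤ} {w : List Step}
    (h : v ∈ cornerSet (snakeFrom t w)) : t.1 ≤ v.1 ∧ t.2 ≤ v.2 := by
  induction w generalizing t with
  | nil =>
    obtain ⟨t', ht', hv⟩ := h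
    simp only [snakeFrom, List.mem_singleton] at ht'
    subst ht'
    rw [mem_tileCorners] at hv
    omega
  | cons s w ih =>
    obtain ⟨t', ht', hv⟩ := h
    simp only [snakeFrom, List.mem_cons] at ht'
    rcases ht' with rfl | ht'
    · rw [mem_tileCorners] at hv
      omega
    · have := ih ⟨t', ht', hv⟩
      cases s <;> simp [stepVec] at this <;> omega

theorem mem_cornerSet_snakeFrom_cons {t v : ℤ × ℤ} {s : Step} {w : List Step} :
    v ∈ cornerSet (snakeFrom t (s :: w)) ↔
      v ∈ tileCorners t ∨ v ∈ cornerSet (snakeFrom (t + stepVec s) w) := by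
  simp [cornerSet, snakeFrom]

/-- Two corners of a snake that are adjacent in the grid span a side of one of its tiles. -/
theorem exists_mem_tileSides_of_adj {t u v : ℤ × ℤ} {w : List Step}
    (hu : u ∈ cornerSet (snakeFrom t w)) (hv : v ∈ cornerSet (snakeFrom t w))
    (h : gridGraph.Adj u v) : ∃ t' ∈ snakeFrom t w, s(u, v) ∈ tileSides t' := by
  induction w generalizing t with
  | nil =>
    obtain ⟨t1, h1, hu⟩ := hu
    obtain ⟨t2, h2, hv⟩ := hv
    simp only [snakeFrom, List.mem_singleton] at h1 h2
    rw [h1] at hu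
    rw [h2] at hv
    exact ⟨t, by simp [snakeFrom], mem_tileSides.2 ⟨hu, hv, h⟩⟩
  | cons s w ih =>
    by_cases hc : u ∈ tileCorners t ∧ v ∈ tileCorners t
    · exact ⟨t, mem_snakeFrom_self _ _, mem_tileSides.2 ⟨hc.1, hc.2, h⟩⟩
    by_cases hc' : u ∈ cornerSet (snakeFrom (t + stepVec s) w) ∧
        v ∈ cornerSet (snakeFrom (t + stepVec s) w)
    · obtain ⟨t', ht', hs⟩ := ih hc'.1 hc'.2
      exact ⟨t', List.mem_cons_of_mem _ ht', hs⟩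
    exfalso
    -- One of the points is a corner of `t` only; the neighbours that the other tiles could supply
    -- are corners of `t` as well.
    have next : ∀ x, x ∈ tileCorners (t + stepVec s) →
        x ∈ cornerSet (snakeFrom (t + stepVec s) w) :=
      fun x => mem_cornerSet_snakeFrom_of_mem w
    have nu := mt (next u)
    have nv := mt (next v)
    rw [mem_cornerSet_snakeFrom_cons] at hu hv
    rw [gridGraph_adj] at h
    have bu := fun h => le_of_mem_cornerSet_snakeFrom (t := t + stepVec s) (v := u) (w := w) h
    have bv := fun h => le_of_mem_cornerSet_snakeFrom (t := t + stepVec s) (v := v) (w := w) h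
    simp only [mem_tileCorners] at hu hv hc nu nv
    by_cases cu : u ∈ cornerSet (snakeFrom (t + stepVec s) w) <;>
      by_cases cv : v ∈ cornerSet (snakeFrom (t + stepVec s) w) <;>
      simp only [cu, cv, not_true_eq_false, not_false_eq_true, true_implies, false_implies,
        or_true, or_false, and_true, and_false, not_and, not_or] at * <;>
      cases s <;> simp only [stepVec, Prod.fst_add, Prod.snd_add] at * <;> omega

/-! ### Counting the perfect matchings of a snake graph -/

/-- The step in the other direction. -/
def Step.flip : Step → Step
  | Step.R => Step.U
  | Step.U => Step.R

/-- The number of perfect matchings of the snake that starts at the tile `t`. -/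
noncomputable def snakeCount (t : ℤ × ℤ) (w : List Step) : ℕ :=
  (matchingPerms gridGraph (cornerSet (snakeFrom t w))).ncard

theorem card_perfectMatching_tileGraph (t : ℤ × ℤ) (w : List Step) :
    Nat.card {P : (tileGraph (snakeFrom t w)).Subgraph // P.IsPerfectMatching} = snakeCount t w :=
  card_perfectMatching_eq_ncard gridGraph _ _ fun x y =>
    ⟨fun ⟨_, _, h⟩ => (mem_tileSides.1 h).2.2, fun h => exists_mem_tileSides_of_adj x.2 y.2 h⟩

/-- The number of perfect matchings of what remains of the snake that starts at the tile `t` after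
deleting the south side (`s = R`) or the west side (`s = U`) of `t` with its endpoints. -/
noncomputable def cutCount (s : Step) (t : ℤ × ℤ) (w : List Step) : ℕ :=
  (matchingPerms gridGraph (cornerSet (snakeFrom t w) \ {t, t + stepVec s})).ncard

theorem snakeCount_eq_add (t : ℤ × ℤ) (w : List Step) :
    snakeCount t w = cutCount Step.R t w + cutCount Step.U t w := by
  have mem : ∀ x, x ∈ tileCorners t → x ∈ cornerSet (snakeFrom t w) :=
    fun x => mem_cornerSet_snakeFrom_of_mem w
  refine ncard_matchingPerms_of_two (finite_cornerSet _) (mem _ ?_) (mem _ ?_) (mem _ ?_) ?_ ?_ ?_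
    fun x hx hadj => ?_
  · simp [mem_tileCorners]
  · simp [mem_tileCorners, stepVec]
  · simp [mem_tileCorners, stepVec]
  · simp [gridGraph_adj, stepVec]
  · simp [gridGraph_adj, stepVec]
  · simp [stepVec]
  · have := le_of_mem_cornerSet_snakeFrom hx
    rw [gridGraph_adj] at hadj
    simp only [stepVec, Prod.ext_iff, Prod.fst_add, Prod.snd_add]
    omega

theorem cornerSet_diff_cons (s : Step) (t : ℤ × ℤ) (w : List Step) :
    cornerSet (snakeFrom t (s :: w)) \ {t, t + stepVec s.flip} =
      cornerSet (snakeFrom (t + stepVec s) w) := by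
  ext v
  simp only [Set.mem_sdiff, mem_cornerSet_snakeFrom_cons, Set.mem_insert_iff,
    Set.mem_singleton_iff, mem_tileCorners]
  have h1 := fun h => le_of_mem_cornerSet_snakeFrom (t := t + stepVec s) (v := v) (w := w) h
  have h2 := fun h => mem_cornerSet_snakeFrom_of_mem (t := t + stepVec s) (v := v) w h
  rw [mem_tileCorners] at h2
  by_cases hv : v ∈ cornerSet (snakeFrom (t + stepVec s) w) <;>
    simp only [hv, true_implies, or_true, or_false, true_and, iff_true, iff_false, imp_false] at * <;>
    cases s <;>
    simp only [stepVec, Step.flip, Prod.fst_add, Prod.snd_add, Prod.ext_iff] at * <;> omega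

theorem cutCount_flip_cons (s : Step) (t : ℤ × ℤ) (w : List Step) :
    cutCount s.flip t (s :: w) = snakeCount (t + stepVec s) w := by
  rw [cutCount, snakeCount, cornerSet_diff_cons]

/-- When the side of the first tile in the direction `s` of the snake is deleted, the side opposite
to it belongs to every matching: its end outside the second tile has no other neighbour left. -/
theorem cutCount_cons (s : Step) (t : ℤ × ℤ) (w : List Step) :
    cutCount s t (s :: w) = cutCount s.flip (t + stepVec s) w := by
  have mem : ∀ x, x ∈ tileCorners t → x ∈ cornerSet (snakeFrom t (s :: w)) :=
    fun x => mem_cornerSet_snakeFrom_of_mem _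
  rw [cutCount, cutCount, ← cornerSet_diff_cons, Set.sdiff_sdiff, ncard_matchingPerms_of_unique
    (S := cornerSet (snakeFrom t (s :: w)) \ {t, t + stepVec s})
    (v := t + stepVec s.flip) (u := t + stepVec s + stepVec s.flip) ⟨mem _ ?_, ?_⟩ ⟨mem _ ?_, ?_⟩]
  · congr 2
    ext x
    simp only [Set.mem_sdiff, Set.mem_union, Set.mem_insert_iff, Set.mem_singleton_iff]
    tauto
  · cases s <;> simp [gridGraph_adj, stepVec, Step.flip]
  · rintro x ⟨hx, hx'⟩ hadj
    have := le_of_mem_cornerSet_snakeFrom hx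
    rw [mem_cornerSet_snakeFrom_cons] at hx
    have hb := fun h => le_of_mem_cornerSet_snakeFrom (t := t + stepVec s) (v := x) (w := w) h
    rw [mem_tileCorners] at hx
    rw [gridGraph_adj] at hadj
    simp only [Set.mem_insert_iff, Set.mem_singleton_iff] at hx'
    by_cases hv : x ∈ cornerSet (snakeFrom (t + stepVec s) w) <;>
    simp only [hv, true_implies, or_true, or_false, false_implies] at * <;>
    cases s <;>
    simp only [stepVec, Step.flip, Prod.fst_add, Prod.snd_add, Prod.ext_iff] at * <;> omega
  all_goals cases s <;> simp [mem_tileCorners, stepVec, Step.flip, Prod.ext_iff]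

theorem cutCount_nil (s : Step) (t : ℤ × ℤ) : cutCount s t [] = 1 := by
  have mem : ∀ x, x ∈ cornerSet (snakeFrom t []) ↔ x ∈ tileCorners t := by
    simp [cornerSet, snakeFrom]
  rw [cutCount, ncard_matchingPerms_of_unique
    (S := cornerSet (snakeFrom t []) \ {t, t + stepVec s})
    (v := t + stepVec s.flip) (u := t + stepVec s + stepVec s.flip) ⟨(mem _).2 ?_, ?_⟩
    ⟨(mem _).2 ?_, ?_⟩]
  · have : (cornerSet (snakeFrom t []) \ {t, t + stepVec s}) \
        {t + stepVec s.flip, t + stepVec s + stepVec s.flip} = ∅ := by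
      ext x
      simp only [Set.mem_sdiff, mem, mem_tileCorners, Set.mem_insert_iff, Set.mem_singleton_iff,
        Set.mem_empty_iff_false, iff_false]
      cases s <;>
      simp only [stepVec, Step.flip, Prod.fst_add, Prod.snd_add, Prod.ext_iff] at * <;> omega
    rw [this]
    have : matchingPerms gridGraph ∅ = {1} := by
      ext σ
      simp only [matchingPerms, Set.mem_ofPred_eq, Set.mem_singleton_iff, Set.mem_empty_iff_false]
      constructor
      · exact fun h => Equiv.ext fun x => h.2.2 x (by simp)
      · rintro rfl; simp
    rw [this, Set.ncard_singleton]
  · cases s <;> simp [gridGraph_adj, stepVec, Step.flip]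
  · rintro x ⟨hx, hx'⟩ hadj
    rw [mem, mem_tileCorners] at hx
    rw [gridGraph_adj] at hadj
    simp only [Set.mem_insert_iff, Set.mem_singleton_iff] at hx'
    cases s <;>
    simp only [stepVec, Step.flip, Prod.fst_add, Prod.snd_add, Prod.ext_iff] at * <;> omega
  all_goals cases s <;> simp [mem_tileCorners, stepVec, Step.flip, Prod.ext_iff]

/-- The matrix of a doubled step, acting on the pair of cut counts (west side, south side) of a
snake when two tiles are put before it. -/
def stepMatrix : Step → Matrix (Fin 2) (Fin 2) ℤ
  | Step.R => !![2, 1; 1, 1]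
  | Step.U => !![1, 1; 1, 2]

/-- The product of the step matrices along a word. -/
def pathMatrix (w : List Step) : Matrix (Fin 2) (Fin 2) ℤ := (w.map stepMatrix).prod

@[simp] theorem pathMatrix_nil : pathMatrix [] = 1 := rfl

theorem pathMatrix_cons (s : Step) (w : List Step) :
    pathMatrix (s :: w) = stepMatrix s * pathMatrix w := by simp [pathMatrix]

theorem pathMatrix_append (u v : List Step) :
    pathMatrix (u ++ v) = pathMatrix u * pathMatrix v := by simp [pathMatrix]

/-- The cut counts of a doubled word are the coordinates of the image of `(1, 1)` under its matrix
product. -/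
theorem cutCount_doubled (t : ℤ × ℤ) (v : List Step) :
    (cutCount Step.U t (v.flatMap fun s => [s, s]) : ℤ) = pathMatrix v 0 0 + pathMatrix v 0 1 ∧
    (cutCount Step.R t (v.flatMap fun s => [s, s]) : ℤ) = pathMatrix v 1 0 + pathMatrix v 1 1 := by
  induction v generalizing t with
  | nil => simp [cutCount_nil]
  | cons s v ih =>
    simp only [List.flatMap_cons, List.cons_append, List.nil_append]
    set d := v.flatMap fun s => [s, s]
    have f1 := cutCount_flip_cons s t (s :: d)
    have f2 := cutCount_cons s t (s :: d)
    have f3 := cutCount_flip_cons s (t + stepVec s) d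
    have f4 := cutCount_cons s (t + stepVec s) d
    rw [snakeCount_eq_add] at f1 f3
    obtain ⟨h1, h2⟩ := ih (t + stepVec s + stepVec s)
    rw [pathMatrix_cons]
    cases s <;> simp only [Step.flip] at f1 f2 f3 f4 <;>
      simp [stepMatrix, Matrix.mul_apply, Fin.sum_univ_two] <;> constructor <;> linarith

theorem map_pointAt_eq_snakeFrom (pre e post : List Step) :
    (List.range' pre.length (e.length + 1)).map
        (fun k => pointAt (pre ++ e ++ post) k - (1, 0)) =
      snakeFrom (pointAt pre pre.length - (1, 0)) e := by
  induction e generalizing pre with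
  | nil => simp [snakeFrom, pointAt]
  | cons s e ih =>
    have := ih (pre ++ [s])
    rw [List.length_cons, List.range'_succ, List.map_cons, snakeFrom]
    congr 1
    · simp [pointAt]
    · have h1 : pointAt (pre ++ [s]) (pre ++ [s]).length - (1, 0) =
          pointAt pre pre.length - (1, 0) + stepVec s := by
        simp only [pointAt, List.take_length]
        cases s <;> simp [stepVec]
      rw [← h1, ← this]
      simp

theorem snakeTiles_eq (v : List Step) :
    snakeTiles (Step.R :: v ++ [Step.U]) = snakeFrom (1, 0) (v.flatMap fun s => [s, s]) := by
  have h := map_pointAt_eq_snakeFrom [Step.R, Step.R] (v.flatMap fun s => [s, s])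
    [Step.U, Step.U]
  have hl : (v.flatMap fun s => [s, s]).length = 2 * v.length := by
    simp [List.length_flatMap, mul_comm]
  have h0 : pointAt [Step.R, Step.R] [Step.R, Step.R].length - (1, 0) = (1, 0) := by decide
  rw [h0, hl] at h
  rw [← h, snakeTiles, tilesAlong]
  have hr : (List.range' 1 (2 * (Step.R :: v ++ [Step.U]).length - 1)).tail.dropLast =
      List.range' [Step.R, Step.R].length (2 * v.length + 1) := by
    have : 2 * (Step.R :: v ++ [Step.U]).length - 1 = 2 * v.length + 1 + 1 + 1 := by simp; omega
    rw [this, List.range'_succ, List.tail_cons, List.range'_concat, List.dropLast_concat]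
    rfl
  rw [← List.map_tail, ← List.map_dropLast, hr]
  simp

/-- The matching number of a path is an entry of its matrix product. -/
theorem matchNumber_eq (v : List Step) :
    (matchNumber (Step.R :: v ++ [Step.U]) : ℤ) = pathMatrix (Step.R :: v ++ [Step.U]) 1 0 := by
  have h1 : matchNumber (Step.R :: v ++ [Step.U]) =
      snakeCount (1, 0) (v.flatMap fun s => [s, s]) := by
    rw [matchNumber, snakeGraph, snakeTiles_eq, card_perfectMatching_tileGraph]
  have h2 : snakeCount (1, 0) (v.flatMap fun s => [s, s]) = _ := snakeCount_eq_add _ _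
  obtain ⟨h3, h4⟩ := cutCount_doubled (1, 0) v
  rw [h1, h2, Nat.cast_add, h3, h4, List.cons_append, pathMatrix_cons, pathMatrix_append]
  simp [pathMatrix, stepMatrix, Matrix.mul_apply, Fin.sum_univ_two]
  ring

/-! ### Cohn matrices and the Markov tree -/

/-- The word at a position of the tree of Christoffel words below the pair `u`, `v`: the root
carries the concatenation `u ++ v`, which replaces `v` in the left and `u` in the right subtree. -/
def christoffelWord (u v : List Step) : List Branch → List Step
  | [] => u ++ v
  | Branch.left :: p => christoffelWord u (u ++ v) p
  | Branch.right :: p => christoffelWord (u ++ v) v p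

theorem det_pathMatrix (w : List Step) : (pathMatrix w).det = 1 := by
  induction w with
  | nil => simp
  | cons s w ih =>
    rw [pathMatrix_cons, Matrix.det_mul, ih]
    cases s <;> simp [stepMatrix, Matrix.det_fin_two]

theorem pathMatrix_mul_self (w : List Step) :
    pathMatrix w * pathMatrix w = (pathMatrix w 0 0 + pathMatrix w 1 1) • pathMatrix w - 1 := by
  have h := det_pathMatrix w
  rw [Matrix.det_fin_two] at h
  ext i j
  fin_cases i <;> fin_cases j <;>
    simp [-zsmul_eq_mul, Matrix.mul_apply, Fin.sum_univ_two] <;>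
    first | ring1 | linear_combination -h

/-- By Cayley–Hamilton, both relations `tr X = 3 m` and `X 1 0 = m` are inherited by the children of
a node, with `m` following the Vieta involutions of the Markov equation. -/
theorem pathMatrix_christoffelWord (p : List Branch) (u v : List Step) (x y z : ℤ)
    (hu : pathMatrix u 1 0 = x) (hv : pathMatrix v 1 0 = z) (hc : pathMatrix (u ++ v) 1 0 = y)
    (tu : pathMatrix u 0 0 + pathMatrix u 1 1 = 3 * x)
    (tv : pathMatrix v 0 0 + pathMatrix v 1 1 = 3 * z)
    (tc : pathMatrix (u ++ v) 0 0 + pathMatrix (u ++ v) 1 1 = 3 * y) :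
    pathMatrix (christoffelWord u v p) 1 0 = (markovNode (x, y, z) p).2.1 := by
  induction p generalizing u v x y z with
  | nil => exact hc
  | cons s p ih =>
    cases s
    · have e : pathMatrix (u ++ (u ++ v)) = (3 * x) • pathMatrix (u ++ v) - pathMatrix v := by
        rw [pathMatrix_append, pathMatrix_append, ← mul_assoc, pathMatrix_mul_self, tu, sub_mul,
          one_mul, smul_mul_assoc]
      refine ih u (u ++ v) x _ y hu hc ?_ tu tc ?_
      · rw [e, Matrix.sub_apply, Matrix.smul_apply, smul_eq_mul, hv, hc]
      · simp only [e, Matrix.sub_apply, Matrix.smul_apply, smul_eq_mul]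
        linear_combination 3 * x * tc - tv
    · have e : pathMatrix (u ++ v ++ v) = (3 * z) • pathMatrix (u ++ v) - pathMatrix u := by
        rw [pathMatrix_append, pathMatrix_append, mul_assoc, pathMatrix_mul_self, tv, mul_sub,
          mul_one, mul_smul_comm]
      refine ih (u ++ v) v y _ z hc hv ?_ tc tv ?_
      · rw [e, Matrix.sub_apply, Matrix.smul_apply, smul_eq_mul, hu, hc]
        ring
      · simp only [e, Matrix.sub_apply, Matrix.smul_apply, smul_eq_mul]
        linear_combination 3 * z * tc - tu

theorem pathMatrix_christoffelWord_root (p : List Branch) :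
    pathMatrix (christoffelWord [Step.R] [Step.R, Step.U] p) 1 0 = markovLabel p := by
  apply pathMatrix_christoffelWord <;> decide

/-! ### Words that stay close to the diagonal -/

/-- The quantity `b x - a y` for the end `(x, y)` of the word `s`. -/
def wordGap (a b : ℕ) (s : List Step) : ℤ := (b : ℤ) * s.count Step.R - (a : ℤ) * s.count Step.U

theorem wordGap_append (a b : ℕ) (s t : List Step) :
    wordGap a b (s ++ t) = wordGap a b s + wordGap a b t := by
  simp only [wordGap, List.count_append]; push_cast; ring

@[simp] theorem wordGap_nil (a b : ℕ) : wordGap a b [] = 0 := by simp [wordGap]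

@[simp] theorem wordGap_cons_R (a b : ℕ) (s : List Step) :
    wordGap a b (Step.R :: s) = b + wordGap a b s := by
  simp [wordGap]; ring

@[simp] theorem wordGap_cons_U (a b : ℕ) (s : List Step) :
    wordGap a b (Step.U :: s) = wordGap a b s - a := by
  simp [wordGap]; ring

theorem wordGap_reverse (a b : ℕ) (s : List Step) : wordGap a b s.reverse = wordGap a b s := by
  simp [wordGap]

theorem count_add_count (s : List Step) : s.count Step.R + s.count Step.U = s.length := by
  induction s with
  | nil => rfl
  | cons x s ih => cases x <;> simp <;> omega

/-- The words from `(0,0)` to `(a,b)` all of whose points lie in the strip `0 ≤ b x - a y < a + b`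
below the diagonal. -/
def IsBalanced (a b : ℕ) (w : List Step) : Prop :=
  w.count Step.R = a ∧ w.count Step.U = b ∧
    ∀ s, s <+: w → 0 ≤ wordGap a b s ∧ wordGap a b s < a + b

theorem prefix_append_cases {s u v : List Step} (h : s <+: u ++ v) :
    s <+: u ∨ ∃ t, t <+: v ∧ s = u ++ t := by
  obtain ⟨r, h⟩ := h
  rcases List.append_eq_append_iff.1 h with ⟨t, h1, -⟩ | ⟨t, h1, h2⟩
  · exact Or.inl ⟨t, h1.symm⟩
  · exact Or.inr ⟨t, ⟨r, h2.symm⟩, h1⟩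

/-- Concatenating balanced words along Farey neighbours: if `n = a + b`, `N = n + n'` and `g`, `G`
are the gaps of the same point of `u` for the two diagonals, then `n G = N g + k` after `k` steps,
and similarly for `v`. -/
theorem IsBalanced.append {a b a' b' : ℕ} {u v : List Step} (hu : IsBalanced a b u)
    (hv : IsBalanced a' b' v) (h : (a : ℤ) * b' - b * a' = 1) :
    IsBalanced (a + a') (b + b') (u ++ v) := by
  obtain ⟨u1, u2, u3⟩ := hu
  obtain ⟨v1, v2, v3⟩ := hv
  have ha : 0 < (a : ℤ) := by
    rcases Nat.eq_zero_or_pos a with rfl | ha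
    · simp only [Nat.cast_zero, zero_mul, zero_sub] at h
      have : 0 ≤ (b : ℤ) * a' := by positivity
      omega
    · exact_mod_cast ha
  have hb' : 0 < (b' : ℤ) := by
    rcases Nat.eq_zero_or_pos b' with rfl | hb
    · simp only [Nat.cast_zero, mul_zero, zero_sub] at h
      have : 0 ≤ (b : ℤ) * a' := by positivity
      omega
    · exact_mod_cast hb
  have hb : 0 ≤ (b : ℤ) := by positivity
  have ha' : 0 ≤ (a' : ℤ) := by positivity
  refine ⟨by simp [u1, v1], by simp [u2, v2], fun s hs => ?_⟩
  rcases prefix_append_cases hs with hs | ⟨t, ht, rfl⟩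
  · obtain ⟨g0, g1⟩ := u3 s hs
    have hk := hs.sublist.length_le
    rw [← count_add_count, ← count_add_count, u1, u2] at hk
    have e : ((a : ℤ) + b) * wordGap (a + a') (b + b') s =
        (a + a' + b + b') * wordGap a b s + (s.count Step.R + s.count Step.U) := by
      simp only [wordGap]
      push_cast
      linear_combination (s.count Step.R + s.count Step.U : ℤ) * h
    zify at hk
    push_cast
    constructor
    · by_contra hneg
      nlinarith
    · by_contra hneg
      nlinarith
  · obtain ⟨g0, g1⟩ := v3 t ht
    have hk := ht.sublist.length_le
    rw [← count_add_count, ← count_add_count, v1, v2] at hk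
    have e : ((a' : ℤ) + b') * wordGap (a + a') (b + b') (u ++ t) =
        (a + a' + b + b') * wordGap a' b' t - (t.count Step.R + t.count Step.U) + (a' + b') := by
      simp only [wordGap, List.count_append, u1, u2]
      push_cast
      linear_combination (a' + b' - t.count Step.R - t.count Step.U : ℤ) * h
    zify at hk
    push_cast
    constructor
    · by_contra hneg
      nlinarith
    · by_contra hneg
      nlinarith

theorem isBalanced_christoffelWord (p : List Branch) (l r : ℕ × ℕ) (u v : List Step)
    (hu : IsBalanced l.2 l.1 u) (hv : IsBalanced r.2 r.1 v)
    (h : (l.2 : ℤ) * r.1 - l.1 * r.2 = 1) :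
    IsBalanced (fareyNode l r p).2 (fareyNode l r p).1 (christoffelWord u v p) := by
  induction p generalizing l r u v with
  | nil => exact hu.append hv h
  | cons s p ih =>
    cases s
    · refine ih l (l + r) u (u ++ v) hu (hu.append hv h) ?_
      simp only [Prod.fst_add, Prod.snd_add]
      push_cast
      linear_combination h
    · refine ih (l + r) r (u ++ v) v (hu.append hv h) hv ?_
      simp only [Prod.fst_add, Prod.snd_add]
      push_cast
      linear_combination h

/-- There is a balanced word from `(0,0)` to `(a,b)` that realizes the Markov number of `b / a`. -/
theorem exists_isBalanced (a b : ℕ) (hb : 0 < b) (hba : b < a) (hab : Nat.Coprime a b) :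
    ∃ w, IsBalanced a b w ∧ pathMatrix w 1 0 = markovNumber ((b : ℚ) / (a : ℚ)) := by
  obtain ⟨p, hp⟩ := exists_fareyNode a (a - b) b (by omega) (by omega) hb
    ((Nat.coprime_sub_self_left hba.le).2 hab) (0, 1) (1, 1)
  have hp2 : (fareyNode (0, 1) (1, 1) p) = (b, a) := by
    rw [hp]; simp [hba.le]
  have hp1 : fareyLabel p = (b : ℚ) / (a : ℚ) := by rw [fareyLabel, hp2]
  have hex : ∃ p : List Branch, fareyLabel p = (b : ℚ) / (a : ℚ) := ⟨p, hp1⟩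
  refine ⟨christoffelWord [Step.R] [Step.R, Step.U] p, ?_, ?_⟩
  · have := isBalanced_christoffelWord p (0, 1) (1, 1) [Step.R] [Step.R, Step.U]
      ⟨rfl, rfl, fun s hs => ?_⟩ ⟨rfl, rfl, fun s hs => ?_⟩ (by norm_num)
    · rwa [hp2] at this
    · simp only [List.prefix_cons_iff, List.prefix_nil] at hs
      rcases hs with rfl | ⟨t, rfl, rfl⟩ <;> simp
    · simp only [List.prefix_cons_iff, List.prefix_nil] at hs
      rcases hs with rfl | ⟨t, rfl, rfl | ⟨t, rfl, rfl⟩⟩ <;> simp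
  · rw [pathMatrix_christoffelWord_root, markovNumber, dif_pos hex,
      (existsUnique_fareyLabel a b hb hba hab).unique hex.choose_spec hp1]

/-! ### The path closest to the diagonal -/

theorem diagGap_pointAt (a b : ℕ) (w : List Step) (k : ℕ) :
    diagGap a b (pointAt w k) = wordGap a b (w.take k) := rfl

theorem mem_latticePaths_iff {a b : ℕ} {w : List Step} :
    w ∈ latticePaths a b ↔
      w.count Step.R = a ∧ w.count Step.U = b ∧ ∀ s, s <+: w → 0 ≤ wordGap a b s := by
  refine and_congr_right fun _ => and_congr_right fun _ => ⟨fun h s hs => ?_, fun h k => ?_⟩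
  · rw [List.prefix_iff_eq_take.1 hs]
    exact h _
  · exact h _ (List.take_prefix _ _)

theorem wordGap_eq_zero_of_counts {a b : ℕ} {w : List Step} (h1 : w.count Step.R = a)
    (h2 : w.count Step.U = b) : wordGap a b w = 0 := by
  rw [wordGap, h1, h2]; ring

theorem IsBalanced.mem_latticePaths {a b : ℕ} {w : List Step} (h : IsBalanced a b w) :
    w ∈ latticePaths a b :=
  mem_latticePaths_iff.2 ⟨h.1, h.2.1, fun s hs => (h.2.2 s hs).1⟩

theorem length_of_mem_latticePaths {a b : ℕ} {w : List Step} (h : w ∈ latticePaths a b) :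
    w.length = a + b := by
  rw [← count_add_count, h.1, h.2.1]

theorem wordGap_eq_sub_length (a b : ℕ) (s : List Step) :
    wordGap a b s = (a + b) * s.count Step.R - a * s.length := by
  rw [← count_add_count, wordGap]; push_cast; ring

/-- After a given number of steps the possible gaps are congruent modulo `a + b`, so a gap in
`[0, a + b)` is the least nonnegative one. -/
theorem IsBalanced.isChristoffelPath {a b : ℕ} {w : List Step} (h : IsBalanced a b w) :
    IsChristoffelPath a b w := by
  refine ⟨h.mem_latticePaths, fun w' hw' k => ?_⟩
  have h1 := (h.2.2 _ (List.take_prefix k w)).2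
  have h2 := hw'.2.2 k
  have hl : (w.take k).length = (w'.take k).length := by
    rw [List.length_take, List.length_take, length_of_mem_latticePaths hw',
      length_of_mem_latticePaths h.mem_latticePaths]
  rw [diagGap_pointAt] at h2 ⊢
  rw [diagGap_pointAt]
  rw [wordGap_eq_sub_length] at h1 h2 ⊢
  rw [wordGap_eq_sub_length, hl]
  rw [hl] at h1
  have h3 : ((w.take k).count Step.R : ℤ) ≤ (w'.take k).count Step.R := by
    by_contra hlt
    push Not at hlt
    have h0 : (0 : ℤ) ≤ a + b := by positivity
    nlinarith
  have h0 : (0 : ℤ) ≤ a + b := by positivity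
  nlinarith

theorem eq_of_count_take_eq {w w' : List Step} (hl : w.length = w'.length)
    (h : ∀ k, (w.take k).count Step.R = (w'.take k).count Step.R) : w = w' := by
  induction w generalizing w' with
  | nil => exact (List.length_eq_zero_iff.1 hl.symm).symm
  | cons s w ih =>
    rcases w' with _ | ⟨s', w'⟩
    · simp at hl
    · have h1 : s = s' := by
        have := h 1
        cases s <;> cases s' <;> simp at this ⊢
      subst h1
      rw [ih (by simpa using hl) fun k => ?_]
      have := h (k + 1)
      simpa [List.count_cons] using this

theorem IsChristoffelPath.unique {a b : ℕ} (hb : 0 < b) {w w' : List Step}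
    (h : IsChristoffelPath a b w) (h' : IsChristoffelPath a b w') : w = w' := by
  have hl : w.length = w'.length := by
    rw [length_of_mem_latticePaths h.1, length_of_mem_latticePaths h'.1]
  refine eq_of_count_take_eq hl fun k => ?_
  have e := le_antisymm (h.2 w' h'.1 k) (h'.2 w h.1 k)
  rw [diagGap_pointAt, diagGap_pointAt, wordGap_eq_sub_length, wordGap_eq_sub_length,
    List.length_take, List.length_take, hl, sub_left_inj] at e
  have h0 : (a + b : ℤ) ≠ 0 := by positivity
  exact_mod_cast mul_left_cancel₀ h0 e

theorem eq_R_of_cons_mem {a b : ℕ} (ha : 0 < a) {s : Step} {w : List Step}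
    (h : s :: w ∈ latticePaths a b) : s = Step.R := by
  have := (mem_latticePaths_iff.1 h).2.2 [s] (by simp)
  cases s
  · rfl
  · simp at this; omega

theorem eq_U_of_append_mem {a b : ℕ} (hb : 0 < b) {s : Step} {w : List Step}
    (h : w ++ [s] ∈ latticePaths a b) : s = Step.U := by
  obtain ⟨h1, h2, h3⟩ := mem_latticePaths_iff.1 h
  have h4 := h3 w (List.prefix_append _ _)
  have h5 := wordGap_eq_zero_of_counts h1 h2
  rw [wordGap_append] at h5
  cases s
  · simp at h5; omega
  · rfl

theorem exists_eq_of_mem_latticePaths {a b : ℕ} (ha : 0 < a) (hb : 0 < b) {w : List Step}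
    (h : w ∈ latticePaths a b) : ∃ v, w = Step.R :: v ++ [Step.U] := by
  rcases w with _ | ⟨s, w⟩
  · have := h.1; simp at this; omega
  · obtain rfl := eq_R_of_cons_mem ha h
    rcases List.eq_nil_or_concat' w with rfl | ⟨v, t, rfl⟩
    · have := h.2.1; simp at this; omega
    · rw [← List.cons_append] at h
      obtain rfl := eq_U_of_append_mem hb h
      exact ⟨v, rfl⟩

theorem matchNumber_eq_of_mem {a b : ℕ} (ha : 0 < a) (hb : 0 < b) {w : List Step}
    (h : w ∈ latticePaths a b) : (matchNumber w : ℤ) = pathMatrix w 1 0 := by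
  obtain ⟨v, rfl⟩ := exists_eq_of_mem_latticePaths ha hb h
  exact matchNumber_eq v

/-! ### Lowering the matching number by a flip -/

/-- The `i`-th row sum of the matrix of a word: a coordinate of the image of `(1, 1)`. -/
def rowSum (l : List Step) (i : Fin 2) : ℤ := pathMatrix l i 0 + pathMatrix l i 1

/-- The determinant of the images of `(1, 1)` under the matrices of two words. It is positive when
the first image has the smaller slope. -/
def wordCross (l m : List Step) : ℤ := rowSum l 0 * rowSum m 1 - rowSum l 1 * rowSum m 0

theorem rowSum_cons_R (l : List Step) :
    rowSum (Step.R :: l) 0 = 2 * rowSum l 0 + rowSum l 1 ∧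
      rowSum (Step.R :: l) 1 = rowSum l 0 + rowSum l 1 := by
  simp only [rowSum, pathMatrix_cons, stepMatrix, Matrix.mul_apply, Fin.sum_univ_two]
  constructor <;> simp <;> ring

theorem rowSum_cons_U (l : List Step) :
    rowSum (Step.U :: l) 0 = rowSum l 0 + rowSum l 1 ∧
      rowSum (Step.U :: l) 1 = rowSum l 0 + 2 * rowSum l 1 := by
  simp only [rowSum, pathMatrix_cons, stepMatrix, Matrix.mul_apply, Fin.sum_univ_two]
  constructor <;> simp <;> ring

theorem rowSum_nil (i : Fin 2) : rowSum [] i = 1 := by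
  fin_cases i <;> simp [rowSum]

theorem rowSum_pos (l : List Step) : 0 < rowSum l 0 ∧ 0 < rowSum l 1 := by
  induction l with
  | nil => simp [rowSum_nil]
  | cons s l ih =>
    cases s
    · rw [(rowSum_cons_R l).1, (rowSum_cons_R l).2]; omega
    · rw [(rowSum_cons_U l).1, (rowSum_cons_U l).2]; omega

theorem wordCross_cons_cons (s : Step) (l m : List Step) :
    wordCross (s :: l) (s :: m) = wordCross l m := by
  cases s
  · simp only [wordCross, rowSum_cons_R]; ring
  · simp only [wordCross, rowSum_cons_U]; ring

/-- The slopes order words lexicographically, with `R` before the end of a word and the end before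
`U`: if the first slope is not the smaller one, then after a common prefix `c` the first word ends
or continues with `U`, and the second ends or continues with `R`. -/
theorem wordCross_pos_or (l m : List Step) : 0 < wordCross l m ∨
    ∃ c, (l = c ∨ ∃ r, l = c ++ Step.U :: r) ∧ (m = c ∨ ∃ r, m = c ++ Step.R :: r) := by
  induction l generalizing m with
  | nil =>
    rcases m with _ | ⟨_ | _, m⟩
    · exact Or.inr ⟨[], by simp⟩
    · exact Or.inr ⟨[], by simp⟩
    · refine Or.inl ?_
      have := rowSum_pos m
      simp only [wordCross, rowSum_cons_U, rowSum_nil]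
      linarith
  | cons s l ih =>
    have hl := rowSum_pos l
    rcases s with _ | _ <;> rcases m with _ | ⟨_ | _, m⟩
    · refine Or.inl ?_
      simp only [wordCross, rowSum_cons_R, rowSum_nil]
      linarith
    · rw [wordCross_cons_cons]
      refine (ih m).imp_right fun ⟨c, h1, h2⟩ => ⟨Step.R :: c, ?_, ?_⟩ <;> simpa
    · refine Or.inl ?_
      have := rowSum_pos m
      simp only [wordCross, rowSum_cons_R, rowSum_cons_U]
      nlinarith [mul_pos hl.1 this.1, mul_pos hl.1 this.2, mul_pos hl.2 this.2]
    · exact Or.inr ⟨[], by simp⟩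
    · exact Or.inr ⟨[], by simp⟩
    · rw [wordCross_cons_cons]
      refine (ih m).imp_right fun ⟨c, h1, h2⟩ => ⟨Step.U :: c, ?_, ?_⟩ <;> simpa

theorem pathMatrix_reverse (w : List Step) :
    pathMatrix w.reverse = (pathMatrix w).transpose := by
  induction w with
  | nil => simp
  | cons s w ih =>
    have hs : pathMatrix [s] = (stepMatrix s).transpose := by
      cases s <;> ext i j <;> fin_cases i <;> fin_cases j <;> simp [pathMatrix, stepMatrix]
    rw [List.reverse_cons, pathMatrix_append, ih, hs, pathMatrix_cons, Matrix.transpose_mul]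

/-- A flip changes the matching number by twice a determinant, since
`A * B - B * A = !![0, 2; -2, 0]` for the matrices `A` of `R` and `B` of `U`. -/
theorem pathMatrix_flip_sub (x y : List Step) :
    pathMatrix (Step.R :: x ++ Step.R :: Step.U :: y ++ [Step.U]) 1 0 -
      pathMatrix (Step.R :: x ++ Step.U :: Step.R :: y ++ [Step.U]) 1 0 =
      2 * wordCross x.reverse y := by
  simp only [wordCross, rowSum, pathMatrix_reverse, Matrix.transpose_apply, pathMatrix_append,
    pathMatrix_cons, pathMatrix_nil, stepMatrix, Matrix.mul_apply, Fin.sum_univ_two]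
  simp
  ring

/-- A path below the diagonal that leaves the strip of balanced words has a corner `R U` of maximal
gap, at least `a + b`. -/
theorem exists_maximal_corner {a b : ℕ} (ha : 0 < a) (hb : 0 < b) {w : List Step}
    (hw : w ∈ latticePaths a b) (hbal : ¬ IsBalanced a b w) :
    ∃ x y, w = Step.R :: x ++ Step.R :: Step.U :: y ++ [Step.U] ∧
      (a + b : ℤ) ≤ wordGap a b (Step.R :: x ++ [Step.R]) ∧
      ∀ s, s <+: w → wordGap a b s ≤ wordGap a b (Step.R :: x ++ [Step.R]) := by
  obtain ⟨h1, h2, h3⟩ := mem_latticePaths_iff.1 hw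
  have hw0 := wordGap_eq_zero_of_counts h1 h2
  obtain ⟨s0, hs0, hg0⟩ : ∃ s, s <+: w ∧ (a + b : ℤ) ≤ wordGap a b s := by
    by_contra! hc
    exact hbal ⟨h1, h2, fun s hs => ⟨h3 s hs, hc s hs⟩⟩
  obtain ⟨s, hs, hmax⟩ := w.inits.toFinset.exists_max_image (wordGap a b) ⟨[], by simp⟩
  simp only [List.mem_toFinset, List.mem_inits] at hs hmax
  have hge : (a + b : ℤ) ≤ wordGap a b s := hg0.trans (hmax s0 hs0)
  obtain ⟨t, rfl⟩ := hs
  rcases List.eq_nil_or_concat' s with rfl | ⟨s, σ, rfl⟩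
  · simp at hge; omega
  obtain rfl : σ = Step.R := by
    cases σ
    · rfl
    · have := hmax s (by simp)
      simp [wordGap_append] at this; omega
  rcases t with _ | ⟨τ, t⟩
  · simp only [List.append_nil] at hw0; omega
  obtain rfl : τ = Step.U := by
    cases τ
    · have := hmax (s ++ [Step.R] ++ [Step.R]) (by simp)
      simp [wordGap_append] at this; omega
    · rfl
  rcases s with _ | ⟨σ, x⟩
  · simp at hge; omega
  obtain rfl := eq_R_of_cons_mem ha (by simpa using hw)
  rcases List.eq_nil_or_concat' t with rfl | ⟨y, τ, rfl⟩
  · rw [wordGap_append] at hw0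
    simp at hw0 hge; omega
  obtain rfl := eq_U_of_append_mem (w := Step.R :: x ++ Step.R :: Step.U :: y) hb
    (by simpa using hw)
  exact ⟨x, y, by simp, hge, hmax⟩

/-- Flipping `R U` to `U R` at a corner of gap at least `a + b` stays below the diagonal. -/
theorem flip_mem_latticePaths {a b : ℕ} {p q : List Step}
    (hw : p ++ Step.R :: Step.U :: q ∈ latticePaths a b)
    (hg : (a + b : ℤ) ≤ wordGap a b (p ++ [Step.R])) :
    p ++ Step.U :: Step.R :: q ∈ latticePaths a b := by
  rw [mem_latticePaths_iff] at hw ⊢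
  obtain ⟨h1, h2, h3⟩ := hw
  refine ⟨by simpa using h1, by simpa using h2, fun s hs => ?_⟩
  rcases prefix_append_cases hs with hs | ⟨t, ht, rfl⟩
  · exact h3 s (hs.trans (List.prefix_append _ _))
  rw [List.prefix_cons_iff] at ht
  rcases ht with rfl | ⟨t, rfl, ht⟩
  · exact h3 _ (by simp)
  rw [List.prefix_cons_iff] at ht
  rcases ht with rfl | ⟨t, rfl, ht⟩
  · simp [wordGap_append] at hg ⊢; omega
  · have := h3 (p ++ Step.R :: Step.U :: t) (by simpa using ht)
    simp [wordGap_append] at this ⊢; omega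

/-- At a corner of maximal gap the flip lowers the matching number. Otherwise the words that leave
the corner backwards and forwards share a prefix `c` whose gap is forced to be `a - b` by the
maximality, and coprimality excludes this. -/
theorem wordCross_pos_of_maximal_corner {a b : ℕ} (hab : Nat.Coprime a b) {x y : List Step}
    (hw : Step.R :: x ++ Step.R :: Step.U :: y ++ [Step.U] ∈ latticePaths a b)
    (hg : (a + b : ℤ) ≤ wordGap a b (Step.R :: x ++ [Step.R]))
    (hmax : ∀ s, s <+: Step.R :: x ++ Step.R :: Step.U :: y ++ [Step.U] →
      wordGap a b s ≤ wordGap a b (Step.R :: x ++ [Step.R])) :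
    0 < wordCross x.reverse y := by
  refine (wordCross_pos_or x.reverse y).resolve_right ?_
  rintro ⟨c, hx, hy⟩
  have hx' : x = c.reverse ∨ ∃ r, x = r ++ Step.U :: c.reverse := by
    rcases hx with h | ⟨r, h⟩
    · exact Or.inl (by rw [← h, List.reverse_reverse])
    · refine Or.inr ⟨r.reverse, ?_⟩
      rw [← List.reverse_reverse x, h]; simp
  obtain ⟨h1, h2, -⟩ := mem_latticePaths_iff.1 hw
  have hw0 := wordGap_eq_zero_of_counts h1 h2
  have hle : c.count Step.R ≤ x.count Step.R := by
    rcases hx' with rfl | ⟨r, rfl⟩ <;> simp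
  have hge : (a : ℤ) - b ≤ wordGap a b c := by
    rcases hx' with rfl | ⟨r, rfl⟩
    · simp [wordGap_append, wordGap_reverse] at hg; omega
    · have := hmax (Step.R :: r) (by simp)
      simp [wordGap_append, wordGap_reverse] at this; omega
  have hle' : wordGap a b c ≤ a - b := by
    rcases hy with rfl | ⟨r, rfl⟩
    · simp [wordGap_append] at hg hw0; omega
    · have := hmax (Step.R :: x ++ Step.R :: Step.U :: c ++ [Step.R]) (by simp)
      simp [wordGap_append] at this; omega
  have e : b * (c.count Step.R + 1) = a * (c.count Step.U + 1) := by
    have := le_antisymm hle' hge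
    simp only [wordGap] at this
    zify
    linarith
  have hdvd : a ∣ c.count Step.R + 1 := hab.dvd_of_dvd_mul_left ⟨_, e⟩
  have := Nat.le_of_dvd (Nat.succ_pos _) hdvd
  simp at h1
  omega

theorem exists_matchingLT_of_not_isBalanced {a b : ℕ} (ha : 0 < a) (hb : 0 < b)
    (hab : Nat.Coprime a b) {w : List Step} (hw : w ∈ latticePaths a b)
    (hbal : ¬ IsBalanced a b w) : ∃ w' ∈ latticePaths a b, MatchingLT w' w := by
  obtain ⟨x, y, rfl, hg, hmax⟩ := exists_maximal_corner ha hb hw hbal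
  have hpos := wordCross_pos_of_maximal_corner hab hw hg hmax
  have hw' : Step.R :: x ++ Step.U :: Step.R :: y ++ [Step.U] ∈ latticePaths a b := by
    have := flip_mem_latticePaths (p := Step.R :: x) (q := y ++ [Step.U]) (by simpa using hw) hg
    simpa using this
  refine ⟨_, hw', ?_⟩
  have h := pathMatrix_flip_sub x y
  rw [← matchNumber_eq_of_mem ha hb hw, ← matchNumber_eq_of_mem ha hb hw'] at h
  rw [MatchingLT]
  omega

theorem IsMatchingMinimal.isBalanced {a b : ℕ} (ha : 0 < a) (hb : 0 < b)
    (hab : Nat.Coprime a b) {w : List Step} (h : IsMatchingMinimal a b w) : IsBalanced a b w := by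
  by_contra hbal
  obtain ⟨w', hw', hlt⟩ := exists_matchingLT_of_not_isBalanced ha hb hab h.1 hbal
  exact h.2 w' hw' hlt

theorem exists_isMatchingMinimal {a b : ℕ} {w : List Step} (hw : w ∈ latticePaths a b) :
    ∃ w', IsMatchingMinimal a b w' := by
  have hwf : WellFounded MatchingLT := InvImage.wf matchNumber wellFounded_lt
  obtain ⟨m, hm, hmin⟩ := hwf.has_min (latticePaths a b) ⟨w, hw⟩
  exact ⟨m, hm, hmin⟩

theorem theorem4p1 (a b : ℕ) (hb : 0 < b) (hba : b < a) (hab : Nat.Coprime a b) :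
    (∃! w₀ : List Step, IsChristoffelPath a b w₀) ∧
      ∀ w₀ : List Step, IsChristoffelPath a b w₀ →
        (matchNumber w₀ : ℤ) = markovNumber ((b : ℚ) / (a : ℚ)) ∧
          ∀ w : List Step, IsMatchingMinimal a b w ↔ w = w₀ := by
  have ha : 0 < a := hb.trans hba
  obtain ⟨c, hc, hM⟩ := exists_isBalanced a b hb hba hab
  refine ⟨⟨c, hc.isChristoffelPath, fun w hw => hw.unique hb hc.isChristoffelPath⟩,
    fun w₀ hw₀ => ?_⟩
  obtain rfl := hw₀.unique hb hc.isChristoffelPath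
  refine ⟨by rw [matchNumber_eq_of_mem ha hb hw₀.1, hM], fun w => ?_⟩
  have key : ∀ w, IsMatchingMinimal a b w → w = w₀ := fun w hw =>
    (hw.isBalanced ha hb hab).isChristoffelPath.unique hb hw₀
  refine ⟨key w, ?_⟩
  rintro rfl
  obtain ⟨m, hm⟩ := exists_isMatchingMinimal hw₀.1
  exact key m hm ▸ hm
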